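/- Let $d\ge 1$, let $\mathbb{D}$ be the open unit disc and $\mathbb{T}$ the unit circle in $\mathbb{C}$, let $$\pi_d(z_1,\dots,z_d)=\Big(\sum_{j} z_j,\ \sum_{i<j}z_iz_j,\ \dots,\ \prod_{j} z_j\Big)$$ be the symmetrization map, and let $\mathbb{G}_d=\pi_d(\mathbb{D}^d)\subset\mathbb{C}^d$ be the symmetrized polydisc. Its distinguished boundary $b\mathbb{G}_d$ is the Shilov boundary of $\mathbb{G}_d$ with respect to the uniform algebra $A(\mathbb{G}_d)$ of functions holomorphic in $\mathbb{G}_d$ and continuous on $\overline{\mathbb{G}_d}$, i.e. the smallest closed subset of $\overline{\mathbb{G}_d}$ on which every function of $A(\mathbb{G}_d)$ attains its maximum modulus (it equals $\pi_d(\mathbb{T}^d)$). A rational inner function on $\mathbb{G}_d$ is a bounded function $g=P/Q$ on $\mathbb{G}_d$, where $P,Q$ are polynomials in $d$ complex variables and $Q$ has no zero in $\mathbb{G}_d$, such that $Q(s)\neq 0$ and $|P(s)/Q(s)|=1$ for almost every $s\in b\mathbb{G}_d$, with respect to the image under $\pi_d$ of Lebesgue measure on $\mathbb{T}^d$. Then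 every holomorphic function $f:\mathbb{G}_d\to\overline{\mathbb{D}}$ can be approximated, uniformly on compact subsets of $\mathbb{G}_d$, by rational inner functions on $\mathbb{G}_d$: there is a sequence $(g_n)$ of rational inner functions on $\mathbb{G}_d$ such that $g_n\to f$ uniformly on every compact subset of $\mathbb{G}_d$. -/

import Mathlib

open MeasureTheory

namespace SymPolydisc

/-- The open polydisc `𝔻^d`. -/
def polydisc (d : ℕ) : Set (Fin d → ℂ) := {z | ∀ j, ‖z j‖ < 1}

/-- The symmetrization map `π_d(z) = (∑ z_j, ∑_{i<j} z_i z_j, …, ∏ z_j)`: its coordinate with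
index `i = 0, …, d - 1` is the elementary symmetric polynomial of degree `i + 1`. -/
noncomputable def symMap (d : ℕ) (z : Fin d → ℂ) : Fin d → ℂ :=
  fun i => MvPolynomial.eval z (MvPolynomial.esymm (Fin d) ℂ ((i : ℕ) + 1))

/-- The symmetrized polydisc `𝔾_d = π_d(𝔻^d)`. -/
def symPolydisc (d : ℕ) : Set (Fin d → ℂ) := symMap d '' polydisc d

/-- Membership in the uniform algebra `A(Ω)`: functions holomorphic in the open set `Ω` and
continuous on its closure. -/
def MemUniformAlgebra {d : ℕ} (Ω : Set (Fin d → ℂ)) (f : (Fin d → ℂ) → ℂ) : Prop :=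
  ContinuousOn f (closure Ω) ∧ DifferentiableOn ℂ f Ω

/-- `B` is a closed boundary for `A(Ω)`: a closed subset of the closure of `Ω` on which each
function of `A(Ω)` attains its maximum modulus. -/
def IsClosedBoundary {d : ℕ} (Ω B : Set (Fin d → ℂ)) : Prop :=
  IsClosed B ∧ B ⊆ closure Ω ∧
    ∀ f, MemUniformAlgebra Ω f → ∀ z ∈ closure Ω, ∃ w ∈ B, ‖f z‖ ≤ ‖f w‖

/-- The distinguished boundary `bΩ`: the Shilov boundary with respect to `A(Ω)`, that is, the
smallest closed boundary (the intersection of all of them). -/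
def distinguishedBoundary {d : ℕ} (Ω : Set (Fin d → ℂ)) : Set (Fin d → ℂ) :=
  ⋂₀ {B | IsClosedBoundary Ω B}

/-- The measure to which "almost every point of `b𝔾_d`" refers: the image under `π_d` of
Lebesgue (arc length) measure on the torus `𝕋^d`, with `𝕋^d` parametrized by
`θ ↦ (e^{iθ_1}, …, e^{iθ_d})`, `θ ∈ [0, 2π]^d`. -/
noncomputable def boundaryMeasure (d : ℕ) : Measure (Fin d → ℂ) :=
  Measure.map (fun θ : Fin d → ℝ => symMap d (fun j => Complex.exp (θ j * Complex.I)))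
    (volume.restrict (Set.Icc 0 (fun _ => 2 * Real.pi)))

/-- `f` is a rational inner function on `𝔾_d`: a bounded function on `𝔾_d` which is a quotient of
two polynomials, the denominator having no zero in `𝔾_d` (so that `f` is holomorphic there), and
this quotient is defined and unimodular at almost every point of the distinguished boundary. -/
def IsRationalInner (d : ℕ) (f : (Fin d → ℂ) → ℂ) : Prop :=
  (∃ C : ℝ, ∀ s ∈ symPolydisc d, ‖f s‖ ≤ C) ∧
  ∃ P Q : MvPolynomial (Fin d) ℂ,
    (∀ s ∈ symPolydisc d,
      MvPolynomial.eval s Q ≠ 0 ∧ f s = MvPolynomial.eval s P / MvPolynomial.eval s Q) ∧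
    ∀ᵐ s ∂(boundaryMeasure d).restrict (distinguishedBoundary (symPolydisc d)),
      MvPolynomial.eval s Q ≠ 0 ∧ ‖MvPolynomial.eval s P / MvPolynomial.eval s Q‖ = 1

end SymPolydisc

namespace SymPolydisc

/-! Pull `f` back to the permutation-invariant function `F = f ∘ π_d` on the polydisc. The dilate `t
F(t z)`, `t < 1`, is close to `F` on compacta, has modulus at most `t` and is holomorphic past the
closed polydisc. So it is uniformly close there to a polynomial; averaging over permutations makes
this a polynomial `P` in the elementary symmetric ones, with `|P ∘ π_d| ≤ c < 1`.

Let `p = s_d` be the last coordinate, the product of the `z_j`. On the torus `conj P = p^(-n) Q` for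
a polynomial `Q`, and `|Q| ≤ c` on the closed polydisc by the maximum principle. Put `g = (P +
p^(N+n)) / (1 + p^N Q)`. On the torus the denominator is `p^(N+n)` times the conjugate of the
numerator, so `|g| = 1`; inside, `g - P` carries a factor `p^N`, which is small on compacta for
large `N`. -/

/-! ### Polynomial approximation on polydiscs. -/

/-- The quotient map by a closed subspace is continuous and linear, so it commutes with the integral
and kills it. A non-integrable family has integral `0` by convention. -/
theorem intervalIntegral_mem {E : Type*} [NormedAddCommGroup E] [NormedSpace ℂ E]
    [CompleteSpace E] (S : Submodule ℂ E) (hS : IsClosed (S : Set E)) {f : ℝ → E} {a b : ℝ}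
    (hf : ∀ t, f t ∈ S) : ∫ t in a..b, f t ∈ S := by
  by_cases hi : IntervalIntegrable f volume a b
  · rw [← Submodule.Quotient.mk_eq_zero]
    have h := ContinuousLinearMap.intervalIntegral_comp_comm (S.mkQL) hi
    have h0 : ∀ t, S.mkQL (f t) = 0 := fun t => (Submodule.Quotient.mk_eq_zero S).2 (hf t)
    simp only [h0, intervalIntegral.integral_zero] at h
    exact h.symm
  · rw [intervalIntegral.integral_undef hi]
    exact S.zero_mem

/-- If a continuous family of vectors in a closed subspace satisfies Cauchy's formula, then it is
uniformly approximated on smaller discs by polynomials with coefficients in the subspace. -/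
theorem exists_sum_pow_smul_near {E : Type*} [NormedAddCommGroup E] [NormedSpace ℂ E]
    [CompleteSpace E] (S : Submodule ℂ E) (hS : IsClosed (S : Set E)) {Φ : ℂ → E} {r ρ : ℝ}
    (hr : 0 ≤ r) (hρ : r < ρ) (hc : ContinuousOn Φ (Metric.closedBall 0 ρ)) (hΦ : ∀ w, Φ w ∈ S)
    (hC : ∀ w ∈ Metric.ball (0 : ℂ) ρ,
      ((2 * Real.pi * Complex.I : ℂ)⁻¹ • ∮ z in C(0, ρ), (z - w)⁻¹ • Φ z) = Φ w)
    {ε : ℝ} (hε : 0 < ε) :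
    ∃ (N : ℕ) (a : ℕ → E), (∀ k, a k ∈ S) ∧
      ∀ w ∈ Metric.closedBall (0 : ℂ) r, ‖Φ w - ∑ k ∈ Finset.range N, w ^ k • a k‖ < ε := by
  have hρ0 : 0 < ρ := hr.trans_lt hρ
  obtain ⟨r', hrr', hr'ρ⟩ := exists_between hρ
  lift ρ to NNReal using hρ0.le
  lift r' to NNReal using (hr.trans hrr'.le)
  have hci : CircleIntegrable Φ 0 ρ :=
    (hc.mono Metric.sphere_subset_closedBall).circleIntegrable ρ.2
  have hs := hasFPowerSeriesOn_cauchy_integral hci (by exact_mod_cast hρ0)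
  have hu := hs.tendstoUniformlyOn (r' := r') (by exact_mod_cast hr'ρ)
  rw [Metric.tendstoUniformlyOn_iff] at hu
  obtain ⟨N, hN⟩ := (hu ε hε).exists
  refine ⟨N, fun k => cauchyPowerSeries Φ 0 ρ k fun _ => 1, fun k => ?_, fun w hw => ?_⟩
  · beta_reduce
    rw [cauchyPowerSeries_apply]
    refine S.smul_mem _ (intervalIntegral_mem S hS fun t => ?_)
    exact S.smul_mem _ (S.smul_mem _ (S.smul_mem _ (hΦ _)))
  · have hw' : w ∈ Metric.ball (0 : ℂ) r' := by
      simp only [Metric.mem_closedBall, Metric.mem_ball, dist_zero_right] at hw ⊢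
      exact hw.trans_lt hrr'
    have h := hN w hw'
    rw [zero_add, hC w (Metric.ball_subset_ball hr'ρ.le hw'), dist_eq_norm] at h
    have hsum : ∑ k ∈ Finset.range N, w ^ k • (cauchyPowerSeries Φ 0 ρ k fun _ => 1) =
        (cauchyPowerSeries Φ 0 ρ).partialSum N w := by
      refine Finset.sum_congr (M := E) rfl fun k _ => ?_
      rw [cauchyPowerSeries_apply, cauchyPowerSeries_apply, smul_comm,
        ← circleIntegral.integral_smul]
      simp only [smul_smul, ← mul_assoc, ← mul_pow, mul_one_div]
    rwa [hsum]

/-- A function holomorphic on a polydisc is uniformly approximated by polynomials on smaller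
concentric polydiscs. -/
theorem exists_mvPolynomial_near (d : ℕ) : ∀ {r R : ℝ}, 0 ≤ r → r < R →
    ∀ {F : (Fin d → ℂ) → ℂ}, DifferentiableOn ℂ F (Metric.ball 0 R) → ∀ {ε : ℝ}, 0 < ε →
    ∃ p : MvPolynomial (Fin d) ℂ, ∀ z ∈ Metric.closedBall (0 : Fin d → ℂ) r,
      ‖F z - MvPolynomial.eval z p‖ < ε := by
  induction d with
  | zero =>
    intro r R _ _ F _ ε hε
    refine ⟨MvPolynomial.C (F 0), fun z _ => ?_⟩
    rw [Subsingleton.elim z 0]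
    simpa using hε
  | succ d ih =>
    intro r R hr hrR F hF ε hε
    obtain ⟨ρ, hrρ, hρR⟩ := exists_between hrR
    have hρ0 : 0 < ρ := hr.trans_lt hrρ
    -- Induction on `d`: `w ↦ F(w, ·)` is viewed as a holomorphic map into the Banach space `C(X,
    -- ℂ)`. By `ih` its values lie in the closure of the polynomials, hence so do its Taylor
    -- coefficients.
    let X := Metric.closedBall (0 : Fin d → ℂ) r
    have : CompactSpace X := isCompact_iff_compactSpace.1 (isCompact_closedBall _ _)
    have hball : ∀ (w : ℂ) (z : Fin d → ℂ), ‖w‖ < R → ‖z‖ < R →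
        (Fin.cons w z : Fin (d + 1) → ℂ) ∈ Metric.ball 0 R := by
      intro w z hw hz
      rw [mem_ball_zero_iff, pi_norm_lt_iff (hr.trans_lt hrR)]
      intro i
      refine Fin.cases ?_ (fun j => ?_) i
      · simpa using hw
      · simpa using (norm_le_pi_norm z j).trans_lt hz
    have hcons : Continuous fun q : ℂ × (Fin d → ℂ) => (Fin.cons q.1 q.2 : Fin (d + 1) → ℂ) := by
      refine continuous_pi fun i => ?_
      refine Fin.cases ?_ (fun j => ?_) i
      · simpa using continuous_fst
      · simp only [Fin.cons_succ]
        fun_prop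
    let G : C(Metric.closedBall (0 : ℂ) ρ × X, ℂ) :=
      ⟨fun q => F (Fin.cons (q.1 : ℂ) (q.2 : Fin d → ℂ)), by
        refine hF.continuousOn.comp_continuous
          (hcons.comp (by fun_prop : Continuous fun q : Metric.closedBall (0 : ℂ) ρ × X =>
            ((q.1 : ℂ), (q.2 : Fin d → ℂ)))) fun q => ?_
        exact hball _ _ ((mem_closedBall_zero_iff.1 q.1.2).trans_lt hρR)
          ((mem_closedBall_zero_iff.1 q.2.2).trans_lt hrR)⟩
    classical
    let Φ : ℂ → C(X, ℂ) := fun w =>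
      if h : w ∈ Metric.closedBall (0 : ℂ) ρ then G.curry ⟨w, h⟩ else 0
    have hΦapply : ∀ w ∈ Metric.closedBall (0 : ℂ) ρ, ∀ x : X,
        Φ w x = F (Fin.cons w (x : Fin d → ℂ)) := by
      intro w hw x
      simp only [Φ, dif_pos hw]
      rfl
    have hΦc : ContinuousOn Φ (Metric.closedBall 0 ρ) := by
      rw [continuousOn_iff_continuous_domRestrict]
      convert G.curry.continuous using 1
      ext1 w
      simp only [Set.domRestrict_apply, Φ, dif_pos w.2]
    let L : MvPolynomial (Fin d) ℂ →ₗ[ℂ] C(X, ℂ) :=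
      { toFun := fun p => ⟨fun x => MvPolynomial.eval (x : Fin d → ℂ) p,
          (MvPolynomial.continuous_eval p).comp continuous_subtype_val⟩
        map_add' := fun p q => by ext x; simp
        map_smul' := fun c p => by ext x; simp [MvPolynomial.smul_eval] }
    have hLapply : ∀ p (x : X), L p x = MvPolynomial.eval (x : Fin d → ℂ) p := fun _ _ => rfl
    have hconsd : ∀ w : ℂ, Differentiable ℂ fun z : Fin d → ℂ => (Fin.cons w z : Fin (d + 1) → ℂ) := by
      intro w
      rw [differentiable_pi]
      intro i
      refine Fin.cases ?_ (fun j => ?_) i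
      · simp
      · simpa using differentiable_apply j
    have hconsd' : ∀ z : Fin d → ℂ, Differentiable ℂ fun w : ℂ => (Fin.cons w z : Fin (d + 1) → ℂ) := by
      intro w
      rw [differentiable_pi]
      intro i
      refine Fin.cases ?_ (fun j => ?_) i
      · simp
      · simp
    have hΦS : ∀ w, Φ w ∈ (LinearMap.range L).topologicalClosure := by
      intro w
      by_cases hw : w ∈ Metric.closedBall (0 : ℂ) ρ
      · rw [← SetLike.mem_coe, Submodule.topologicalClosure_coe, Metric.mem_closure_iff]
        intro δ hδ
        obtain ⟨p, hp⟩ := ih hr hrR (F := fun z => F (Fin.cons w z))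
          (hF.comp (hconsd w).differentiableOn fun z hz =>
            hball _ _ ((mem_closedBall_zero_iff.1 hw).trans_lt hρR) (mem_ball_zero_iff.1 hz)) hδ
        refine ⟨L p, ⟨p, rfl⟩, ?_⟩
        rw [ContinuousMap.dist_lt_iff hδ]
        intro x
        rw [hΦapply w hw, hLapply, dist_eq_norm]
        exact hp x x.2
      · simp only [Φ, dif_neg hw]
        exact Submodule.zero_mem _
    have hΦC : ∀ w ∈ Metric.ball (0 : ℂ) ρ,
        ((2 * Real.pi * Complex.I : ℂ)⁻¹ • ∮ z in C(0, ρ), (z - w)⁻¹ • Φ z) = Φ w := by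
      intro w hw
      ext x
      have hd : DiffContOnCl ℂ (fun z => F (Fin.cons z (x : Fin d → ℂ))) (Metric.ball 0 ρ) := by
        apply DifferentiableOn.diffContOnCl
        refine hF.comp (hconsd' _).differentiableOn fun z hz => ?_
        exact hball _ _
          ((mem_closedBall_zero_iff.1 (Metric.closure_ball_subset_closedBall hz)).trans_lt hρR)
          ((mem_closedBall_zero_iff.1 x.2).trans_lt hrR)
      have hci : CircleIntegrable (fun z => (z - w)⁻¹ • Φ z) 0 ρ := by
        refine ContinuousOn.circleIntegrable hρ0.le ?_
        refine ContinuousOn.smul (f := fun z : ℂ => (z - w)⁻¹)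
          (ContinuousOn.inv₀ (by fun_prop) fun z hz h0 => ?_)
          (hΦc.mono Metric.sphere_subset_closedBall)
        rw [sub_eq_zero.1 h0, mem_sphere_zero_iff_norm] at hz
        rw [mem_ball_zero_iff] at hw
        exact hw.ne hz
      rw [hΦapply w (Metric.ball_subset_closedBall hw),
        ← hd.two_pi_i_inv_smul_circleIntegral_sub_inv_smul hw, ContinuousMap.smul_apply]
      congr 1
      rw [circleIntegral, circleIntegral]
      refine ((ContinuousMap.evalCLM ℂ x).intervalIntegral_comp_comm hci.out).symm.trans ?_
      refine intervalIntegral.integral_congr fun t _ => ?_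
      simp only [ContinuousMap.evalCLM_apply, ContinuousMap.smul_apply]
      rw [hΦapply _ (circleMap_mem_closedBall _ hρ0.le _)]
    obtain ⟨N, a, ha, haΦ⟩ := exists_sum_pow_smul_near _
      (Submodule.isClosed_topologicalClosure _) hr hrρ hΦc hΦS hΦC (half_pos hε)
    -- These tolerances, weighted by `‖z 0‖ ^ k ≤ r ^ k`, add up to at most `ε / 2`; the `+ 1`s only
    -- avoid zero denominators.
    have hq : ∀ k, ∃ q : MvPolynomial (Fin d) ℂ,
        ‖a k - L q‖ < ε / (2 * (N + 1) * (r ^ k + 1)) := by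
      intro k
      have hk := ha k
      rw [← SetLike.mem_coe, Submodule.topologicalClosure_coe, Metric.mem_closure_iff] at hk
      obtain ⟨_, ⟨q, rfl⟩, hq⟩ := hk (ε / (2 * (N + 1) * (r ^ k + 1))) (by positivity)
      exact ⟨q, by rwa [dist_eq_norm] at hq⟩
    choose q hq using hq
    refine ⟨∑ k ∈ Finset.range N, MvPolynomial.X 0 ^ k * MvPolynomial.rename Fin.succ (q k),
      fun z hz => ?_⟩
    have hz' := mem_closedBall_zero_iff.1 hz
    have hz0 : ‖z 0‖ ≤ r := (norm_le_pi_norm z 0).trans hz'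
    have hzt : Fin.tail z ∈ X := by
      rw [mem_closedBall_zero_iff, pi_norm_le_iff_of_nonneg hr]
      exact fun i => (norm_le_pi_norm z _).trans hz'
    let x : X := ⟨Fin.tail z, hzt⟩
    have hFz : F z = Φ (z 0) x := by
      rw [hΦapply _ (mem_closedBall_zero_iff.2 (hz0.trans hrρ.le)), Fin.cons_self_tail]
    have he : MvPolynomial.eval z
        (∑ k ∈ Finset.range N, MvPolynomial.X 0 ^ k * MvPolynomial.rename Fin.succ (q k)) =
        (∑ k ∈ Finset.range N, (z 0) ^ k • L (q k)) x := by
      simp only [map_sum, map_mul, map_pow, MvPolynomial.eval_X, MvPolynomial.eval_rename,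
        ContinuousMap.coe_sum, Finset.sum_apply, ContinuousMap.coe_smul, Pi.smul_apply, hLapply,
        smul_eq_mul]
      rfl
    rw [hFz, he, ← ContinuousMap.sub_apply]
    refine (ContinuousMap.norm_coe_le_norm _ x).trans_lt ?_
    have h1 := haΦ (z 0) (mem_closedBall_zero_iff.2 hz0)
    have h2 : ‖∑ k ∈ Finset.range N, (z 0) ^ k • a k - ∑ k ∈ Finset.range N, (z 0) ^ k • L (q k)‖
        ≤ ε / 2 := by
      rw [← Finset.sum_sub_distrib]
      have hle : ∀ k ∈ Finset.range N, ‖(z 0) ^ k • a k - (z 0) ^ k • L (q k)‖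
          ≤ ε / (2 * (N + 1)) := by
        intro k _
        rw [← smul_sub, norm_smul, norm_pow]
        calc ‖z 0‖ ^ k * ‖a k - L (q k)‖
            ≤ (r ^ k + 1) * (ε / (2 * (N + 1) * (r ^ k + 1))) := by
              refine mul_le_mul ?_ (hq k).le (norm_nonneg _) (by positivity)
              exact (pow_le_pow_left₀ (norm_nonneg _) hz0 k).trans (by simp)
          _ = ε / (2 * (N + 1)) := by
              have : r ^ k + 1 ≠ 0 := by positivity
              field_simp
      refine (norm_sum_le_of_le _ hle).trans ?_
      rw [Finset.sum_const, Finset.card_range, nsmul_eq_mul, mul_div_assoc', div_le_div_iff₀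
        (by positivity) (by positivity)]
      nlinarith
    calc _ = ‖(Φ (z 0) - ∑ k ∈ Finset.range N, (z 0) ^ k • a k) +
          (∑ k ∈ Finset.range N, (z 0) ^ k • a k - ∑ k ∈ Finset.range N, (z 0) ^ k • L (q k))‖ := by
            rw [sub_add_sub_cancel]
      _ < ε / 2 + ε / 2 := (norm_add_le _ _).trans_lt (add_lt_add_of_lt_of_le h1 h2)
      _ = ε := add_halves ε

/-! ### The symmetrization map and its fibres. -/

theorem continuous_symMap (d : ℕ) : Continuous (symMap d) :=
  continuous_pi fun _ => MvPolynomial.continuous_eval _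

theorem differentiable_mvPolynomial_eval {d : ℕ} (p : MvPolynomial (Fin d) ℂ) :
    Differentiable ℂ fun z : Fin d → ℂ => MvPolynomial.eval z p := by
  induction p using MvPolynomial.induction_on with
  | C a => simp
  | add p q hp hq => simp only [map_add]; exact hp.add hq
  | mul_X p i hp => simp only [map_mul, MvPolynomial.eval_X]; exact hp.mul (differentiable_apply i)

theorem differentiable_symMap (d : ℕ) : Differentiable ℂ (symMap d) :=
  differentiable_pi.2 fun _ => differentiable_mvPolynomial_eval _

theorem symMap_comp_perm {d : ℕ} (z : Fin d → ℂ) (σ : Equiv.Perm (Fin d)) :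
    symMap d (z ∘ σ) = symMap d z := by
  ext i
  simp only [symMap]
  rw [← MvPolynomial.eval_rename, MvPolynomial.rename_esymm]

theorem polydisc_eq_ball {d : ℕ} : polydisc d = Metric.ball 0 1 := by
  ext z
  rw [mem_ball_zero_iff, pi_norm_lt_iff one_pos]
  rfl

theorem eval_prod_X_add_C {d : ℕ} (z : Fin d → ℂ) (t : ℂ) :
    ∏ i, (t + z i) = ∑ j ∈ Finset.range (d + 1),
      MvPolynomial.eval z (MvPolynomial.esymm (Fin d) ℂ j) * t ^ (d - j) := by
  have h := congrArg (fun p => Polynomial.eval t (p.map (MvPolynomial.eval z)))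
    (MvPolynomial.prod_C_add_X_eq_sum_esymm ℂ (Fin d))
  simpa [Polynomial.map_prod, Polynomial.eval_prod, Polynomial.map_sum, Polynomial.eval_finsetSum]
    using h

/-- The image under `symMap` determines `∏ (t + z i)` as a polynomial in `t`; evaluate at the root
`t = -z j`. -/
theorem symMap_fibre {d : ℕ} {z w : Fin d → ℂ} (h : symMap d z = symMap d w) (j : Fin d) :
    ∃ i, z j = w i := by
  have he : ∀ k ∈ Finset.range (d + 1), MvPolynomial.eval z (MvPolynomial.esymm (Fin d) ℂ k) =
      MvPolynomial.eval w (MvPolynomial.esymm (Fin d) ℂ k) := by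
    intro k hk
    rw [Finset.mem_range] at hk
    cases k with
    | zero => simp
    | succ k => exact congrFun h ⟨k, by omega⟩
  have hp : ∏ i, (-z j + z i) = ∏ i, (-z j + w i) := by
    rw [eval_prod_X_add_C, eval_prod_X_add_C]
    exact Finset.sum_congr rfl fun k hk => by rw [he k hk]
  rw [Finset.prod_eq_zero (Finset.mem_univ j) (neg_add_cancel _)] at hp
  obtain ⟨i, -, hi⟩ := Finset.prod_eq_zero_iff.1 hp.symm
  exact ⟨i, by linear_combination -hi⟩

theorem symMap_last {d : ℕ} (hd : 1 ≤ d) (z : Fin d → ℂ) :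
    symMap d z ⟨d - 1, by omega⟩ = ∏ i, z i := by
  have h := eval_prod_X_add_C z 0
  rw [Finset.sum_range_succ, Finset.sum_eq_zero] at h
  · simp only [zero_add, Nat.sub_self, pow_zero, mul_one] at h
    rw [h]
    simp only [symMap]
    rw [Nat.sub_add_cancel hd]
  · intro k hk
    rw [Finset.mem_range] at hk
    rw [zero_pow (by omega), mul_zero]

/-- A compact subset of the symmetrized polydisc is covered by a smaller closed polydisc. -/
theorem exists_radius_of_isCompact {d : ℕ} {K : Set (Fin d → ℂ)} (hK : IsCompact K)
    (hKd : K ⊆ symPolydisc d) :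
    ∃ r < 1, K ⊆ symMap d '' Metric.closedBall 0 r := by
  have hL : IsCompact (Metric.closedBall (0 : Fin d → ℂ) 1 ∩ symMap d ⁻¹' K) :=
    (isCompact_closedBall _ _).inter_right (hK.isClosed.preimage (continuous_symMap d))
  -- Every fibre over `K` lies wholly in the open polydisc, so the norm has a maximum below `1` on
  -- the compact preimage.
  have hlt : ∀ z ∈ Metric.closedBall (0 : Fin d → ℂ) 1 ∩ symMap d ⁻¹' K, ‖z‖ < 1 := by
    rintro z ⟨-, hz⟩
    obtain ⟨w, hw, hwz⟩ := hKd hz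
    rw [pi_norm_lt_iff one_pos]
    intro j
    obtain ⟨i, hi⟩ := symMap_fibre hwz.symm j
    rw [hi]
    exact hw i
  have hmem : ∀ s ∈ K, ∃ z ∈ Metric.closedBall (0 : Fin d → ℂ) 1 ∩ symMap d ⁻¹' K,
      symMap d z = s := by
    intro s hs
    obtain ⟨w, hw, rfl⟩ := hKd hs
    rw [polydisc_eq_ball] at hw
    exact ⟨w, ⟨Metric.ball_subset_closedBall hw, hs⟩, rfl⟩
  rcases K.eq_empty_or_nonempty with rfl | ⟨s, hs⟩
  · exact ⟨0, one_pos, Set.empty_subset _⟩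
  · obtain ⟨z, hz, -⟩ := hmem s hs
    obtain ⟨z₀, hz₀, hmax⟩ := hL.exists_isMaxOn ⟨z, hz⟩ continuous_norm.continuousOn
    refine ⟨‖z₀‖, hlt z₀ hz₀, fun s hs => ?_⟩
    obtain ⟨z, hz, rfl⟩ := hmem s hs
    exact ⟨z, mem_closedBall_zero_iff.2 (hmax hz), rfl⟩

theorem eval_aeval_esymm {d : ℕ} (z : Fin d → ℂ) (Q : MvPolynomial (Fin d) ℂ) :
    MvPolynomial.eval z (MvPolynomial.aeval
      (fun i : Fin d => MvPolynomial.esymm (Fin d) ℂ (i + 1)) Q) =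
      MvPolynomial.eval (symMap d z) Q := by
  induction Q using MvPolynomial.induction_on with
  | C a => simp
  | add p q hp hq => simp only [map_add, hp, hq]
  | mul_X p i hp => simp only [map_mul, hp, MvPolynomial.aeval_X, MvPolynomial.eval_X, symMap]

/-- The average of a polynomial over all permutations of the variables is a polynomial in the
elementary symmetric polynomials. -/
theorem exists_eval_symMap_eq_average {d : ℕ} (q : MvPolynomial (Fin d) ℂ) :
    ∃ Q : MvPolynomial (Fin d) ℂ, ∀ z, MvPolynomial.eval (symMap d z) Q =
      (Fintype.card (Equiv.Perm (Fin d)) : ℂ)⁻¹ *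
        ∑ σ : Equiv.Perm (Fin d), MvPolynomial.eval (z ∘ σ) q := by
  let p : MvPolynomial (Fin d) ℂ := MvPolynomial.C (Fintype.card (Equiv.Perm (Fin d)) : ℂ)⁻¹ *
    ∑ σ : Equiv.Perm (Fin d), MvPolynomial.rename σ q
  have hp : p.IsSymmetric := by
    intro τ
    simp only [p, map_mul, MvPolynomial.rename_C, map_sum, MvPolynomial.rename_rename]
    congr 1
    exact Equiv.sum_comp (Equiv.mulLeft τ) fun σ : Equiv.Perm (Fin d) => MvPolynomial.rename σ q
  obtain ⟨Q, hQ⟩ := MvPolynomial.esymmAlgHom_surjective (σ := Fin d) ℂ (n := d) (by simp) ⟨p, hp⟩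
  refine ⟨Q, fun z => ?_⟩
  have h := congrArg (MvPolynomial.eval z) (congrArg Subtype.val hQ)
  rw [MvPolynomial.esymmAlgHom_apply, eval_aeval_esymm] at h
  rw [h]
  simp [p, MvPolynomial.eval_rename]

/-! ### Reflection in the torus and the maximum principle. -/

/-- On the torus, the conjugate of a polynomial is, up to a power of the product of the variables,
again a polynomial. -/
theorem exists_conj_on_torus {d : ℕ} (p : MvPolynomial (Fin d) ℂ) :
    ∃ (n : ℕ) (q : MvPolynomial (Fin d) ℂ), ∀ z : Fin d → ℂ, (∀ i, ‖z i‖ = 1) →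
      MvPolynomial.eval z q = (∏ i, z i) ^ n * (starRingEnd ℂ) (MvPolynomial.eval z p) := by
  induction p using MvPolynomial.induction_on with
  | C a => exact ⟨0, MvPolynomial.C ((starRingEnd ℂ) a), fun z _ => by simp⟩
  | add p₁ p₂ h₁ h₂ =>
    obtain ⟨n₁, q₁, h₁⟩ := h₁
    obtain ⟨n₂, q₂, h₂⟩ := h₂
    refine ⟨n₁ + n₂, (∏ i, MvPolynomial.X i) ^ n₂ * q₁ + (∏ i, MvPolynomial.X i) ^ n₁ * q₂,
      fun z hz => ?_⟩
    simp only [map_add, map_mul, map_pow, map_prod, MvPolynomial.eval_X, h₁ z hz, h₂ z hz]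
    ring
  | mul_X p i h =>
    obtain ⟨n, q, h⟩ := h
    -- On the torus `conj (z i) = 1 / z i`, so the extra factor `∏ z` leaves the product of the
    -- other variables.
    refine ⟨n + 1, q * ∏ j ∈ Finset.univ.erase i, MvPolynomial.X j, fun z hz => ?_⟩
    have hi : z i * (starRingEnd ℂ) (z i) = 1 := by
      rw [Complex.mul_conj, Complex.normSq_eq_norm_sq, hz i]
      simp
    simp only [map_mul, map_prod, MvPolynomial.eval_X, h z hz, pow_succ]
    rw [← Finset.mul_prod_erase _ z (Finset.mem_univ i)]
    linear_combination (-(z i * ∏ j ∈ Finset.univ.erase i, z j) ^ n *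
      (starRingEnd ℂ) (MvPolynomial.eval z p) * ∏ j ∈ Finset.univ.erase i, z j) * hi

/-- The maximum principle on the polydisc: bounds on the torus propagate to the polydisc. -/
theorem norm_le_of_torus {d : ℕ} {F : (Fin d → ℂ) → ℂ} (hF : Differentiable ℂ F) {c : ℝ}
    (h : ∀ z : Fin d → ℂ, (∀ i, ‖z i‖ = 1) → ‖F z‖ ≤ c) {z : Fin d → ℂ}
    (hz : ∀ i, ‖z i‖ ≤ 1) : ‖F z‖ ≤ c := by
  -- One variable at a time: only the coordinates in `S` may lie off the unit circle.
  suffices H : ∀ (S : Finset (Fin d)) (z : Fin d → ℂ), (∀ i, ‖z i‖ ≤ 1) →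
      (∀ i, i ∉ S → ‖z i‖ = 1) → ‖F z‖ ≤ c from
    H Finset.univ z hz fun i hi => absurd (Finset.mem_univ i) hi
  intro S
  induction S using Finset.induction_on with
  | empty => exact fun z _ hz => h z fun i => hz i (Finset.notMem_empty i)
  | insert a S _ ih =>
    intro z hz hzS
    have hd : Differentiable ℂ fun w : ℂ => F (Function.update z a w) :=
      hF.comp fun w => (hasFDerivAt_update z w).differentiableAt
    have hb := Complex.norm_le_of_forall_mem_frontier_norm_le (U := Metric.ball (0 : ℂ) 1)
      Metric.isBounded_ball hd.diffContOnCl (C := c) (z := z a) ?_ ?_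
    · simpa using hb
    · intro w hw
      rw [frontier_ball _ one_ne_zero, mem_sphere_zero_iff_norm] at hw
      refine ih _ (fun i => ?_) fun i hi => ?_
      · rcases eq_or_ne i a with rfl | hia
        · simp [hw]
        · simpa [hia] using hz i
      · rcases eq_or_ne i a with rfl | hia
        · simp [hw]
        · simpa [hia] using hzS i (by simp [hia, hi])
    · rw [closure_ball _ one_ne_zero, mem_closedBall_zero_iff]
      exact hz a

theorem average_const {d : ℕ} (a : ℂ) :
    (Fintype.card (Equiv.Perm (Fin d)) : ℂ)⁻¹ * ∑ _σ : Equiv.Perm (Fin d), a = a := by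
  rw [Finset.sum_const, Finset.card_univ, nsmul_eq_mul, inv_mul_cancel_left₀]
  exact Nat.cast_ne_zero.2 Fintype.card_ne_zero

/-- The conjugate of a polynomial on the image of the torus under the symmetrization map is, up to
a power of the last coordinate, again a polynomial. -/
theorem exists_conj_on_symMap_torus {d : ℕ} (P : MvPolynomial (Fin d) ℂ) :
    ∃ (n : ℕ) (Q : MvPolynomial (Fin d) ℂ), ∀ z : Fin d → ℂ, (∀ i, ‖z i‖ = 1) →
      MvPolynomial.eval (symMap d z) Q =
        (∏ i, z i) ^ n * (starRingEnd ℂ) (MvPolynomial.eval (symMap d z) P) := by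
  obtain ⟨n, q, hq⟩ := exists_conj_on_torus
    (MvPolynomial.aeval (fun i : Fin d => MvPolynomial.esymm (Fin d) ℂ (i + 1)) P)
  obtain ⟨Q, hQ⟩ := exists_eval_symMap_eq_average q
  refine ⟨n, Q, fun z hz => ?_⟩
  -- The right-hand side is symmetric, so averaging `q` does not change its values on the torus.
  rw [hQ, ← average_const (d := d) ((∏ i, z i) ^ n * _)]
  congr 1
  refine Finset.sum_congr rfl fun σ _ => ?_
  rw [hq (z ∘ σ) fun i => hz (σ i), eval_aeval_esymm, symMap_comp_perm]
  simp only [Function.comp_apply, Equiv.prod_comp σ z]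

/-! ### Construction of the rational inner functions. -/

/-- Polynomials of modulus at most `c < 1` on the symmetrized polydisc are limits of rational inner
functions. -/
theorem exists_isRationalInner_near {d : ℕ} (hd : 1 ≤ d) (P : MvPolynomial (Fin d) ℂ) {c : ℝ}
    (hc : c < 1) (hP : ∀ z : Fin d → ℂ, ‖z‖ ≤ 1 → ‖MvPolynomial.eval (symMap d z) P‖ ≤ c)
    {r ε : ℝ} (hr : r < 1) (hε : 0 < ε) :
    ∃ g, IsRationalInner d g ∧
      ∀ z : Fin d → ℂ, ‖z‖ ≤ r → ‖g (symMap d z) - MvPolynomial.eval (symMap d z) P‖ < ε := by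
  obtain ⟨n, Q, hQ⟩ := exists_conj_on_symMap_torus P
  let l : Fin d := ⟨d - 1, by omega⟩
  have hl : ∀ z, symMap d z l = ∏ i, z i := symMap_last hd
  have hc0 : 0 ≤ c := (norm_nonneg _).trans (hP 0 (by simp))
  have htorus : ∀ z : Fin d → ℂ, (∀ i, ‖z i‖ = 1) → ‖z‖ ≤ 1 := fun z hz =>
    (pi_norm_le_iff_of_nonneg zero_le_one).2 fun i => (hz i).le
  have hQc : ∀ z : Fin d → ℂ, ‖z‖ ≤ 1 → ‖MvPolynomial.eval (symMap d z) Q‖ ≤ c := by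
    intro z hz
    refine norm_le_of_torus ((differentiable_mvPolynomial_eval Q).comp (differentiable_symMap d))
      (fun w hw => ?_) fun i => (norm_le_pi_norm z i).trans hz
    rw [Function.comp_apply, hQ w hw, norm_mul, norm_pow, norm_prod,
      Finset.prod_eq_one fun i _ => hw i, one_pow, one_mul, RCLike.norm_conj]
    exact hP w (htorus w hw)
  have hprod : ∀ (z : Fin d → ℂ), ‖z‖ ≤ 1 → ‖symMap d z l‖ ≤ ‖z‖ := by
    intro z hz
    rw [hl, norm_prod, ← Finset.mul_prod_erase _ _ (Finset.mem_univ l)]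
    refine (mul_le_of_le_one_right (norm_nonneg _) ?_).trans (norm_le_pi_norm z l)
    exact Finset.prod_le_one (fun _ _ => norm_nonneg _) fun i _ => (norm_le_pi_norm z i).trans hz
  -- Here `2` will bound `p^n - P Q` and `1 - c` bounds the denominator from below; `max r 0` covers
  -- negative `r`.
  obtain ⟨N, hN⟩ : ∃ N : ℕ, max r 0 ^ N * (2 / (1 - c)) < ε := by
    have h1 : 0 < 1 - c := by linarith
    obtain ⟨N, hN⟩ := exists_pow_lt_of_lt_one (show 0 < ε / (2 / (1 - c)) by positivity)
      (max_lt hr one_pos)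
    exact ⟨N, (lt_div_iff₀ (by positivity)).1 hN⟩
  let A : MvPolynomial (Fin d) ℂ := P + MvPolynomial.X l ^ (N + n)
  let B : MvPolynomial (Fin d) ℂ := 1 + MvPolynomial.X l ^ N * Q
  have hA : ∀ s, MvPolynomial.eval s A = MvPolynomial.eval s P + s l ^ (N + n) := by simp [A]
  have hB : ∀ s, MvPolynomial.eval s B = 1 + s l ^ N * MvPolynomial.eval s Q := by simp [B]
  have hpow : ∀ z : Fin d → ℂ, ‖z‖ ≤ 1 → ∀ m, ‖symMap d z l ^ m‖ ≤ 1 := fun z hz m => by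
    rw [norm_pow]
    exact pow_le_one₀ (norm_nonneg _) ((hprod z hz).trans hz)
  have hBc : ∀ z : Fin d → ℂ, ‖z‖ ≤ 1 → 1 - c ≤ ‖MvPolynomial.eval (symMap d z) B‖ := by
    intro z hz
    rw [hB]
    have h1 := norm_sub_le_norm_add (1 : ℂ) (symMap d z l ^ N * MvPolynomial.eval (symMap d z) Q)
    have h2 : ‖symMap d z l ^ N * MvPolynomial.eval (symMap d z) Q‖ ≤ 1 * c := by
      rw [norm_mul]
      exact mul_le_mul (hpow z hz N) (hQc z hz) (norm_nonneg _) zero_le_one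
    rw [norm_one] at h1
    linarith
  have hB0 : ∀ z : Fin d → ℂ, ‖z‖ ≤ 1 → MvPolynomial.eval (symMap d z) B ≠ 0 := by
    intro z hz
    rw [← norm_pos_iff]
    linarith [hBc z hz]
  have hsP : ∀ s ∈ symPolydisc d, ∃ z, ‖z‖ ≤ 1 ∧ symMap d z = s := by
    rintro _ ⟨z, hz, rfl⟩
    rw [polydisc_eq_ball, mem_ball_zero_iff] at hz
    exact ⟨z, hz.le, rfl⟩
  refine ⟨fun s => MvPolynomial.eval s A / MvPolynomial.eval s B, ⟨⟨2 / (1 - c), ?_⟩, A, B, ?_, ?_⟩,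
    ?_⟩
  · intro s hs
    obtain ⟨z, hz, rfl⟩ := hsP s hs
    rw [norm_div]
    refine div_le_div₀ zero_le_two ?_ (by linarith) (hBc z hz)
    rw [hA]
    linarith [norm_add_le (MvPolynomial.eval (symMap d z) P) (symMap d z l ^ (N + n)),
      hP z hz, hpow z hz (N + n)]
  · intro s hs
    obtain ⟨z, hz, rfl⟩ := hsP s hs
    exact ⟨hB0 z hz, rfl⟩
  -- Unimodularity holds on all of `π_d(𝕋^d)`, so the Shilov boundary need not be identified.
  · refine ae_restrict_of_ae ?_
    have hm : Measurable fun θ : Fin d → ℝ =>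
        symMap d (fun j => Complex.exp (θ j * Complex.I)) :=
      ((continuous_symMap d).comp (by fun_prop)).measurable
    have hmA := (MvPolynomial.continuous_eval A).measurable
    have hmB := (MvPolynomial.continuous_eval B).measurable
    rw [boundaryMeasure, ae_map_iff hm.aemeasurable]
    · refine Filter.Eventually.of_forall fun θ => ?_
      set z : Fin d → ℂ := fun j => Complex.exp (θ j * Complex.I)
      have hz : ∀ i, ‖z i‖ = 1 := fun i => Complex.norm_exp_ofReal_mul_I _
      refine ⟨hB0 z (htorus z hz), ?_⟩
      rw [norm_div, div_eq_one_iff_eq (norm_ne_zero_iff.2 (hB0 z (htorus z hz)))]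
      have hu : ∀ m, ‖symMap d z l ^ m‖ = 1 := fun m => by
        rw [norm_pow, hl, norm_prod, Finset.prod_eq_one fun i _ => hz i, one_pow]
      have hu' : (starRingEnd ℂ) (symMap d z l ^ (N + n)) * symMap d z l ^ (N + n) = 1 := by
        rw [mul_comm, Complex.mul_conj, Complex.normSq_eq_norm_sq, hu]
        simp
      have hAB : MvPolynomial.eval (symMap d z) B =
          symMap d z l ^ (N + n) * (starRingEnd ℂ) (MvPolynomial.eval (symMap d z) A) := by
        rw [hA, hB, hQ z hz, ← hl, map_add, mul_add, mul_comm _ ((starRingEnd ℂ) (_ ^ _)), hu']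
        ring
      rw [hAB, norm_mul, hu, one_mul, RCLike.norm_conj]
    · exact (hmB (measurableSet_singleton 0).compl).inter
        ((hmA.div hmB).norm (measurableSet_singleton 1))
  · intro z hz
    have hz1 : ‖z‖ ≤ 1 := hz.trans hr.le
    have hne := hB0 z hz1
    have hdiff : MvPolynomial.eval (symMap d z) A / MvPolynomial.eval (symMap d z) B -
        MvPolynomial.eval (symMap d z) P = symMap d z l ^ N *
          ((symMap d z l ^ n - MvPolynomial.eval (symMap d z) P * MvPolynomial.eval (symMap d z) Q) /
            MvPolynomial.eval (symMap d z) B) := by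
      field_simp
      rw [hA, hB]
      ring
    rw [hdiff, norm_mul, norm_pow, norm_div]
    refine lt_of_le_of_lt (mul_le_mul ?_ ?_ (by positivity) (by positivity)) hN
    · exact pow_le_pow_left₀ (norm_nonneg _) (((hprod z hz1).trans hz).trans (le_max_left _ _)) _
    · refine div_le_div₀ zero_le_two ?_ (by linarith) (hBc z hz1)
      refine (norm_sub_le _ _).trans ?_
      rw [norm_mul]
      have := mul_le_mul (hP z hz1) (hQc z hz1) (norm_nonneg _) hc0
      nlinarith [hpow z hz1 n]

/-! ### Symmetric polynomial approximation and conclusion. -/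

/-- A function into the closed unit disc, holomorphic on the unit polydisc and invariant under
permutations, is approximated on smaller polydiscs by polynomials in the elementary symmetric
polynomials whose modulus stays below `1` on the closed polydisc. -/
theorem exists_symmetric_mvPolynomial_near {d : ℕ} {F : (Fin d → ℂ) → ℂ}
    (hF : DifferentiableOn ℂ F (Metric.ball 0 1)) (hF1 : ∀ z : Fin d → ℂ, ‖z‖ < 1 → ‖F z‖ ≤ 1)
    (hsym : ∀ (z : Fin d → ℂ) (σ : Equiv.Perm (Fin d)), F (z ∘ σ) = F z) {r ε : ℝ} (hr : r < 1)
    (hε : 0 < ε) :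
    ∃ c < 1, ∃ P : MvPolynomial (Fin d) ℂ,
      (∀ z : Fin d → ℂ, ‖z‖ ≤ 1 → ‖MvPolynomial.eval (symMap d z) P‖ ≤ c) ∧
      ∀ z : Fin d → ℂ, ‖z‖ ≤ r → ‖F z - MvPolynomial.eval (symMap d z) P‖ < ε := by
  have huc := (isCompact_closedBall (0 : Fin d → ℂ) r).uniformContinuousOn_of_continuous
    (hF.continuousOn.mono (Metric.closedBall_subset_ball hr))
  obtain ⟨δ, hδ, huc⟩ := Metric.uniformContinuousOn_iff.1 huc (ε / 4) (by positivity)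
  obtain ⟨t, ht, ht1⟩ := exists_between (max_lt (sub_lt_self 1 (lt_min hδ (by positivity : 0 < ε / 4)))
    (one_pos (α := ℝ)))
  have ht0 : 0 < t := (le_max_right _ _).trans_lt ht
  have htδ : 1 - t < δ := by
    linarith [(le_max_left _ _).trans_lt ht, min_le_left δ (ε / 4)]
  have htε : 1 - t < ε / 4 := by
    linarith [(le_max_left _ _).trans_lt ht, min_le_right δ (ε / 4)]
  have hsmul : ∀ z : Fin d → ℂ, ‖(t : ℂ) • z‖ = t * ‖z‖ := fun z => by
    rw [norm_smul, Complex.norm_real, Real.norm_of_nonneg ht0.le]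
  -- `η < 1 - t` keeps the final bound `c = t + η` below `1`. Moving the argument, scaling by `t`
  -- and the polynomial error each cost at most `ε / 4`.
  obtain ⟨η, hη0, hη⟩ := exists_between (lt_min (by linarith : 0 < 1 - t) (by positivity : 0 < ε / 4))
  obtain ⟨hη1, hη2⟩ := lt_min_iff.1 hη
  have hdil : DifferentiableOn ℂ (fun z : Fin d → ℂ => (t : ℂ) * F ((t : ℂ) • z))
      (Metric.ball 0 (1 / t)) := by
    refine (hF.comp (differentiable_id.const_smul (t : ℂ)).differentiableOn fun z hz => ?_).const_mul _
    rw [mem_ball_zero_iff] at hz ⊢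
    change ‖(t : ℂ) • z‖ < 1
    rw [hsmul]
    calc t * ‖z‖ < t * (1 / t) := mul_lt_mul_of_pos_left hz ht0
      _ = 1 := mul_one_div_cancel ht0.ne'
  obtain ⟨q, hq⟩ := exists_mvPolynomial_near d zero_le_one (one_lt_one_div ht0 ht1) hdil hη0
  obtain ⟨P, hP⟩ := exists_eval_symMap_eq_average q
  have hPF : ∀ z : Fin d → ℂ, ‖z‖ ≤ 1 →
      ‖(t : ℂ) * F ((t : ℂ) • z) - MvPolynomial.eval (symMap d z) P‖ ≤ η := by
    intro z hz
    rw [hP, ← average_const (d := d) ((t : ℂ) * F _), ← mul_sub, ← Finset.sum_sub_distrib, norm_mul,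
      norm_inv, Complex.norm_natCast]
    have hle : ∀ σ ∈ (Finset.univ : Finset (Equiv.Perm (Fin d))),
        ‖(t : ℂ) * F ((t : ℂ) • z) - MvPolynomial.eval (z ∘ σ) q‖ ≤ η := by
      intro σ _
      have hzσ : ‖z ∘ σ‖ ≤ 1 :=
        (pi_norm_le_iff_of_nonneg zero_le_one).2 fun i => (norm_le_pi_norm z _).trans hz
      have h := hq (z ∘ σ) (mem_closedBall_zero_iff.2 hzσ)
      rw [← hsym ((t : ℂ) • z) σ]
      exact h.le
    rw [inv_mul_le_iff₀ (Nat.cast_pos.2 Fintype.card_pos)]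
    refine (norm_sum_le_of_le _ hle).trans ?_
    rw [Finset.sum_const, Finset.card_univ, nsmul_eq_mul]
  have ht1' : ∀ z : Fin d → ℂ, ‖z‖ ≤ 1 → ‖F ((t : ℂ) • z)‖ ≤ 1 := fun z hz => by
    refine hF1 _ ?_
    rw [hsmul]
    nlinarith
  refine ⟨t + η, by linarith, P, fun z hz => ?_, fun z hz => ?_⟩
  · have h1 := norm_sub_norm_le (MvPolynomial.eval (symMap d z) P) ((t : ℂ) * F ((t : ℂ) • z))
    rw [norm_sub_rev] at h1
    have h2 : ‖(t : ℂ) * F ((t : ℂ) • z)‖ ≤ t := by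
      rw [norm_mul, Complex.norm_real, Real.norm_of_nonneg ht0.le]
      nlinarith [ht1' z hz]
    linarith [hPF z hz]
  · have hz1 : ‖z‖ ≤ 1 := hz.trans hr.le
    have h1 : ‖F z - F ((t : ℂ) • z)‖ < ε / 4 := by
      rw [← dist_eq_norm]
      refine huc z (mem_closedBall_zero_iff.2 hz) _ (mem_closedBall_zero_iff.2 ?_) ?_
      · rw [hsmul]
        nlinarith [norm_nonneg z]
      · have : z - (t : ℂ) • z = ((1 - t : ℝ) : ℂ) • z := by
          push_cast
          rw [sub_smul, one_smul]
        rw [dist_eq_norm, this, norm_smul, Complex.norm_real, Real.norm_of_nonneg (by linarith)]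
        nlinarith [norm_nonneg z]
    have h2 : ‖F ((t : ℂ) • z) - (t : ℂ) * F ((t : ℂ) • z)‖ ≤ 1 - t := by
      have : F ((t : ℂ) • z) - (t : ℂ) * F ((t : ℂ) • z) =
          ((1 - t : ℝ) : ℂ) * F ((t : ℂ) • z) := by
        push_cast
        ring
      rw [this, norm_mul, Complex.norm_real, Real.norm_of_nonneg (by linarith)]
      nlinarith [ht1' z hz1]
    have h3 := norm_sub_le_norm_sub_add_norm_sub (F z) (F ((t : ℂ) • z))
      (MvPolynomial.eval (symMap d z) P)
    have h4 := norm_sub_le_norm_sub_add_norm_sub (F ((t : ℂ) • z)) ((t : ℂ) * F ((t : ℂ) • z))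
      (MvPolynomial.eval (symMap d z) P)
    linarith [hPF z hz1]

end SymPolydisc

theorem mainTheorem2 (d : ℕ) (hd : 1 ≤ d) (f : (Fin d → ℂ) → ℂ)
    (hf : DifferentiableOn ℂ f (SymPolydisc.symPolydisc d))
    (hf1 : ∀ s ∈ SymPolydisc.symPolydisc d, ‖f s‖ ≤ 1) :
    ∃ g : ℕ → (Fin d → ℂ) → ℂ,
      (∀ n, SymPolydisc.IsRationalInner d (g n)) ∧
      ∀ K ⊆ SymPolydisc.symPolydisc d, IsCompact K →
        TendstoUniformlyOn g f Filter.atTop K := by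
  have hmem : ∀ z : Fin d → ℂ, ‖z‖ < 1 →
      SymPolydisc.symMap d z ∈ SymPolydisc.symPolydisc d := fun z hz => by
    refine ⟨z, ?_, rfl⟩
    rwa [SymPolydisc.polydisc_eq_ball, mem_ball_zero_iff]
  have hF : DifferentiableOn ℂ (f ∘ SymPolydisc.symMap d) (Metric.ball 0 1) :=
    hf.comp (SymPolydisc.differentiable_symMap d).differentiableOn fun z hz =>
      hmem z (mem_ball_zero_iff.1 hz)
  -- The radii `1 - 1 / (n + 1)` exhaust the polydisc while the errors tend to `0`, so one sequence
  -- serves every compact set.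
  have hstep : ∀ n : ℕ, ∃ g, SymPolydisc.IsRationalInner d g ∧ ∀ z : Fin d → ℂ,
      ‖z‖ ≤ 1 - 1 / ((n : ℝ) + 1) → ‖f (SymPolydisc.symMap d z) - g (SymPolydisc.symMap d z)‖ <
        1 / ((n : ℝ) + 1) := by
    intro n
    have hn : 0 < 1 / ((n : ℝ) + 1) := Nat.one_div_pos_of_nat
    obtain ⟨c, hc, P, hPc, hP⟩ := SymPolydisc.exists_symmetric_mvPolynomial_near hF
      (fun z hz => hf1 _ (hmem z hz))
      (fun z σ => congrArg f (SymPolydisc.symMap_comp_perm z σ)) (sub_lt_self 1 hn) (half_pos hn)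
    obtain ⟨g, hg, hgP⟩ := SymPolydisc.exists_isRationalInner_near hd P hc hPc (sub_lt_self 1 hn)
      (half_pos hn)
    refine ⟨g, hg, fun z hz => ?_⟩
    have h1 := hP z hz
    have h2 := hgP z hz
    rw [norm_sub_rev] at h2
    have h3 := norm_sub_le_norm_sub_add_norm_sub (f (SymPolydisc.symMap d z))
      (MvPolynomial.eval (SymPolydisc.symMap d z) P) (g (SymPolydisc.symMap d z))
    rw [Function.comp_apply] at h1
    linarith
  choose g hg hgf using hstep
  refine ⟨g, hg, fun K hKd hK => ?_⟩
  obtain ⟨r, hr, hKr⟩ := SymPolydisc.exists_radius_of_isCompact hK hKd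
  rw [Metric.tendstoUniformlyOn_iff]
  intro ε hε
  filter_upwards [tendsto_one_div_add_atTop_nhds_zero_nat.eventually
    (gt_mem_nhds (lt_min hε (sub_pos.2 hr)))] with n hn s hs
  obtain ⟨hn1, hn2⟩ := lt_min_iff.1 hn
  obtain ⟨z, hz, rfl⟩ := hKr hs
  rw [dist_eq_norm]
  exact (hgf n z ((mem_closedBall_zero_iff.1 hz).trans (by linarith))).trans hn1
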